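/- Let $\mathcal H$ be a complex Hilbert space, let $\mathcal A\subseteq B(\mathcal H)$ be a von Neumann algebra and let $\tau:\mathcal A\to\mathcal A$ be a normal unital completely positive map. For a linear map $\sigma$ on a von Neumann algebra and $\lambda\in\mathbb C$ put $E_\lambda(\sigma)=\{x:\sigma(x)=\lambda x\}$, let $\mathbb T=\{\lambda\in\mathbb C:|\lambda|=1\}$, and let $\mathcal P(\sigma)$ be the norm closure of the linear span of $\bigcup_{\lambda\in\mathbb T}E_\lambda(\sigma)$. Let $(\mathcal K,\mathcal B,\theta)$ be the minimal dilation of $\tau$: $\mathcal K\supseteq\mathcal H$ is a Hilbert space, with orthogonal projection $p$ of $\mathcal K$ onto $\mathcal H$, and $x\in B(\mathcal H)$ is identified with $pxp\in B(\mathcal K)$; $\mathcal B\subseteq B(\mathcal K)$ is a von Neumann algebra containing $\mathcal A$ with $p\mathcal Bp=\mathcal A$; $\theta:\mathcal B\to\mathcal B$ is a normal unital $*$-endomorphism with $\tau^n(x)=p\,\theta^n(x)\,p$ for all $x\in\mathcal A$ and $n\ge 0$; $\mathcal K$ is the closed linear span of the vectors $\theta^n(x_n)\theta^{n-1}(x_{n-1})\cdots\theta(x_1)h$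 with $n\ge0$, $x_1,\dots,x_n\in\mathcal A$, $h\in\mathcal H$; and $\mathcal B$ is the von Neumann algebra generated by $\{\theta^n(x): n\ge 0,\ x\in\mathcal A\}$. (Such a triple is unique up to unitary equivalence fixing $\mathcal H$.) Then the compression $T(z)=pzp$ restricts to a bijection $\mathcal P(\theta)\to\mathcal P(\tau)$, so that $x\circ y:=T\bigl(T^{-1}(x)\,T^{-1}(y)\bigr)$, with $T^{-1}:\mathcal P(\tau)\to\mathcal P(\theta)$, is a well-defined product on $\mathcal P(\tau)$. For all $\lambda,\mu\in\mathbb T$, all $x\in E_\lambda(\tau)$ and all $y\in E_\mu(\tau)$, $$x\circ y\in E_{\lambda\mu}(\tau).$$ In particular, $x\circ y=0$ if $\lambda\mu$ is not in the point spectrum of $\tau$ (that is, not an eigenvalue of $\tau$). -/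

import Mathlib

open scoped InnerProductSpace

noncomputable section

namespace PeripheralBoundary

variable {H : Type*} [NormedAddCommGroup H] [InnerProductSpace ℂ H] [CompleteSpace H]
variable {K : Type*} [NormedAddCommGroup K] [InnerProductSpace ℂ K] [CompleteSpace K]

/-- The ultraweak (σ-weak) topology on `B(H)`: the coarsest topology that makes every functional
`x ↦ ∑ₙ ⟪ξₙ, x ηₙ⟫` continuous, for square-summable sequences `ξ`, `η` in `H`. -/
@[reducible]
def ultraweak (H : Type*) [NormedAddCommGroup H] [InnerProductSpace ℂ H] :
    TopologicalSpace (H →L[ℂ] H) :=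
  ⨅ (ξ : ℕ → H) (η : ℕ → H) (_ : Summable fun n => ‖ξ n‖ ^ 2) (_ : Summable fun n => ‖η n‖ ^ 2),
    TopologicalSpace.induced (fun x : H →L[ℂ] H => ∑' n, ⟪ξ n, x (η n)⟫_ℂ) inferInstance

/-- A self-map of a von Neumann algebra is normal if it is continuous for the ultraweak topology. -/
def IsNormal {A : VonNeumannAlgebra H} (f : A.toStarSubalgebra → A.toStarSubalgebra) : Prop :=
  @Continuous _ _ ((ultraweak H).induced Subtype.val) ((ultraweak H).induced Subtype.val) f

/-- Complete positivity: for every `k`, applying `τ` entrywise maps positive `k × k` matrices over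
`A` to positive ones. Positivity is taken in the C⋆-algebra `M_k(B(H))`, of which `M_k(A)` is a
C⋆-subalgebra. -/
def IsCompletelyPositive {A : VonNeumannAlgebra H}
    (τ : A.toStarSubalgebra →ₗ[ℂ] A.toStarSubalgebra) : Prop :=
  ∀ (k : ℕ) (M : CStarMatrix (Fin k) (Fin k) A.toStarSubalgebra),
    0 ≤ M.map (fun a => (a : H →L[ℂ] H)) → 0 ≤ M.map (fun a => (τ a : H →L[ℂ] H))

/-- A normal unital completely positive map on a von Neumann algebra. -/
structure IsNormalUCP {A : VonNeumannAlgebra H}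
    (τ : A.toStarSubalgebra →ₗ[ℂ] A.toStarSubalgebra) : Prop where
  completelyPositive : IsCompletelyPositive τ
  map_one : τ 1 = 1
  normal : IsNormal τ

/-- The identification of `x ∈ B(H)` with an operator on a larger space `K ⊇ H`, the inclusion being
the isometry `V`: the operator `V x V⋆`, which is `x` on `H` and `0` on the complement of `H`. -/
def extend (V : H →ₗᵢ[ℂ] K) (x : H →L[ℂ] H) : K →L[ℂ] K :=
  V.toContinuousLinearMap ∘L x ∘L V.toContinuousLinearMap.adjoint

/-- The compression `V⋆ z V` of `z ∈ B(K)` to `H`. With `p = V V⋆` the projection onto `H`, it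
satisfies `extend V (compress V z) = p z p`. -/
def compress (V : H →ₗᵢ[ℂ] K) (z : K →L[ℂ] K) : H →L[ℂ] H :=
  V.toContinuousLinearMap.adjoint ∘L z ∘L V.toContinuousLinearMap

/-- The product `θⁿ(bₙ) θⁿ⁻¹(bₙ₋₁) ⋯ θ(b₁)`, which is `1` for `n = 0`. -/
def word {R : Type*} [Monoid R] (θ : R → R) (b : ℕ → R) : ℕ → R
  | 0 => 1
  | n + 1 => θ^[n + 1] (b (n + 1)) * word θ b n

/-- A minimal dilation `(K, B, θ)` of `τ : A → A`. The inclusion of `H` in `K` is the isometry `V`,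
and `A` is regarded as a subset of `B(K)` through `extend V`. -/
structure MinimalDilation {A : VonNeumannAlgebra H}
    (τ : A.toStarSubalgebra →ₗ[ℂ] A.toStarSubalgebra)
    (K : Type*) [NormedAddCommGroup K] [InnerProductSpace ℂ K] [CompleteSpace K] where
  /-- the inclusion of `H` in `K` -/
  V : H →ₗᵢ[ℂ] K
  /-- the von Neumann algebra on `K` -/
  B : VonNeumannAlgebra K
  /-- the unital `⋆`-endomorphism -/
  θ : B.toStarSubalgebra →⋆ₐ[ℂ] B.toStarSubalgebra
  /-- `A ⊆ B`; together with the next field this says `A = p B p` -/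
  extend_mem : ∀ x : A.toStarSubalgebra, extend V x ∈ B.toStarSubalgebra
  /-- `p B p ⊆ A` -/
  compress_mem : ∀ z : B.toStarSubalgebra, compress V z ∈ A.toStarSubalgebra
  normal : IsNormal θ
  /-- `τⁿ(x) = p θⁿ(x) p` -/
  dilation : ∀ (n : ℕ) (x : A.toStarSubalgebra),
    ((τ^[n] x : A.toStarSubalgebra) : H →L[ℂ] H) = compress V (θ^[n] ⟨extend V x, extend_mem x⟩)
  /-- `K` is the closed span of the vectors `θⁿ(xₙ) θⁿ⁻¹(xₙ₋₁) ⋯ θ(x₁) h` with `h ∈ H` -/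
  minimal_space :
    (Submodule.span ℂ {k : K | ∃ (n : ℕ) (x : ℕ → A.toStarSubalgebra) (h : H),
      k = (word (R := B.toStarSubalgebra) θ
        (fun i => ⟨extend V (x i), extend_mem (x i)⟩) n).1 (V h)}
    ).topologicalClosure = ⊤
  /-- `B` is the smallest von Neumann algebra containing all `θⁿ(x)` with `x ∈ A` -/
  minimal_algebra : ∀ C : VonNeumannAlgebra K,
    (∀ (n : ℕ) (x : A.toStarSubalgebra),
      ((θ^[n] ⟨extend V x, extend_mem x⟩ : B.toStarSubalgebra) : K →L[ℂ] K) ∈ C) → B ≤ C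

/-- The norm closure `P(σ)` of the span of the peripheral eigenvectors of `σ : A → A`. -/
def peripheral {A : VonNeumannAlgebra H}
    (σ : A.toStarSubalgebra →ₗ[ℂ] A.toStarSubalgebra) : Submodule ℂ A.toStarSubalgebra :=
  (Submodule.span ℂ {x | ∃ l : ℂ, ‖l‖ = 1 ∧ x ∈ Module.End.eigenspace σ l}).topologicalClosure

namespace MinimalDilation

variable {A : VonNeumannAlgebra H} {τ : A.toStarSubalgebra →ₗ[ℂ] A.toStarSubalgebra}

/-- The compression map `T : B → A`, `z ↦ p z p`. -/
def T (D : MinimalDilation τ K) (z : D.B.toStarSubalgebra) : A.toStarSubalgebra :=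
  ⟨compress D.V z, D.compress_mem z⟩

/-- The space `P(θ)` of the endomorphism of the dilation. -/
def peripheralθ (D : MinimalDilation τ K) : Submodule ℂ D.B.toStarSubalgebra :=
  peripheral D.θ.toAlgHom.toLinearMap

/-- The inverse of the restriction of `T` to `P(θ)`. -/
def lift (D : MinimalDilation τ K) : A.toStarSubalgebra → D.B.toStarSubalgebra :=
  Function.invFunOn D.T D.peripheralθ

/-- The product `x ∘ y = T (T⁻¹(x) T⁻¹(y))` of the peripheral Poisson boundary `P(τ)`. -/
def prod (D : MinimalDilation τ K) (x y : A.toStarSubalgebra) : A.toStarSubalgebra :=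
  D.T (D.lift x * D.lift y)

end MinimalDilation

end PeripheralBoundary

end

open Filter Topology

noncomputable section

namespace PeripheralBoundary

variable {H : Type*} [NormedAddCommGroup H] [InnerProductSpace ℂ H] [CompleteSpace H]
variable {K : Type*} [NormedAddCommGroup K] [InnerProductSpace ℂ K] [CompleteSpace K]

/-! Since `θ` is multiplicative, a product of eigenvectors of `θ` is an eigenvector for the product
of the eigenvalues (or zero), and `T` intertwines `θ` with `τ` (`T_θ`). It remains to see that `T`
matches the peripheral spaces, eigenvectors lifting to eigenvectors.

Write `p_n = θⁿ(p)`. Unitality of `τ` makes the `p_n` increase, and minimality of `K` makes them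
tend strongly to `1` (`tendsto_proj`). If `τ x = λx`, then `a_n = λ⁻ⁿθⁿ(x)` is bounded and `p_n
a_{n+k} p_n = a_n`, so it converges strongly, like a martingale, to an eigenvector of `θ` that
compresses to `x` (`exists_eigenvector_lift`).

For a finite sum `z = ∑ z_i` of eigenvectors, `z = θⁿ(∑ λ_i⁻ⁿ z_i)`, whence `‖p_n z p_n‖ ≤ ‖T(∑
λ_i⁻ⁿ z_i)‖`. Along `n` with all `λ_i⁻ⁿ` near `1` this gives `‖z‖ ≤ ‖T z‖`
(`norm_le_norm_T_of_sum`). Hence `T` is isometric on `P(θ)`. -/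

theorem isClosed_vonNeumannAlgebra (A : VonNeumannAlgebra H) :
    IsClosed (A.toStarSubalgebra : Set (H →L[ℂ] H)) := by
  rw [VonNeumannAlgebra.coe_toStarSubalgebra, ← A.centralizer_centralizer]
  exact Set.isClosed_centralizer _

/-- A von Neumann algebra is closed under pointwise limits of operators. -/
theorem mem_of_tendsto_apply (A : VonNeumannAlgebra H) {u : ℕ → A.toStarSubalgebra}
    {z : H →L[ℂ] H} (h : ∀ ξ, Tendsto (fun n => (u n).1 ξ) atTop (𝓝 (z ξ))) :
    z ∈ A.toStarSubalgebra := by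
  change z ∈ A
  rw [← A.commutant_commutant, VonNeumannAlgebra.mem_commutant_iff]
  intro g hg
  rw [VonNeumannAlgebra.mem_commutant_iff] at hg
  ext ξ
  refine tendsto_nhds_unique ((g.continuous.tendsto _).comp (h ξ)) ?_
  refine (h (g ξ)).congr fun n => ?_
  exact DFunLike.congr_fun (hg (u n).1 (u n).2) ξ

/-! ### Compression and extension along an isometry -/

theorem compress_extend (V : H →ₗᵢ[ℂ] K) (x : H →L[ℂ] H) : compress V (extend V x) = x := by
  have h : ∀ v, V.toContinuousLinearMap.adjoint (V v) = v := fun v =>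
    DFunLike.congr_fun V.adjoint_comp_self v
  ext v
  simp [compress, extend, h]

theorem extend_compress (V : H →ₗᵢ[ℂ] K) (z : K →L[ℂ] K) :
    extend V (compress V z) = extend V 1 * z * extend V 1 := rfl

theorem extend_mul (V : H →ₗᵢ[ℂ] K) (x y : H →L[ℂ] H) :
    extend V (x * y) = extend V x * extend V y := by
  have h : ∀ v, V.toContinuousLinearMap.adjoint (V v) = v := fun v =>
    DFunLike.congr_fun V.adjoint_comp_self v
  ext v
  simp [extend, h]

theorem star_extend (V : H →ₗᵢ[ℂ] K) (x : H →L[ℂ] H) :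
    star (extend V x) = extend V (star x) := by
  simp [extend, ContinuousLinearMap.star_eq_adjoint, ContinuousLinearMap.adjoint_comp,
    ContinuousLinearMap.comp_assoc]

theorem extend_apply_V (V : H →ₗᵢ[ℂ] K) (x : H →L[ℂ] H) (v : H) :
    extend V x (V v) = V (x v) := by
  have h : ∀ v, V.toContinuousLinearMap.adjoint (V v) = v := fun v =>
    DFunLike.congr_fun V.adjoint_comp_self v
  simp [extend, h]

theorem norm_extend_le (V : H →ₗᵢ[ℂ] K) (x : H →L[ℂ] H) : ‖extend V x‖ ≤ ‖x‖ := by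
  have hV := V.norm_toContinuousLinearMap_le
  have hV' : ‖V.toContinuousLinearMap.adjoint‖ ≤ 1 := by
    rwa [LinearIsometryEquiv.norm_map]
  calc ‖extend V x‖ ≤ ‖V.toContinuousLinearMap‖ * (‖x‖ * ‖V.toContinuousLinearMap.adjoint‖) :=
        (ContinuousLinearMap.opNorm_comp_le _ _).trans
          (by gcongr; exact ContinuousLinearMap.opNorm_comp_le _ _)
    _ ≤ 1 * (‖x‖ * 1) := by gcongr
    _ = ‖x‖ := by ring

theorem norm_compress_le (V : H →ₗᵢ[ℂ] K) (z : K →L[ℂ] K) : ‖compress V z‖ ≤ ‖z‖ := by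
  have hV := V.norm_toContinuousLinearMap_le
  have hV' : ‖V.toContinuousLinearMap.adjoint‖ ≤ 1 := by
    rwa [LinearIsometryEquiv.norm_map]
  calc ‖compress V z‖ ≤ ‖V.toContinuousLinearMap.adjoint‖ * (‖z‖ * ‖V.toContinuousLinearMap‖) :=
        (ContinuousLinearMap.opNorm_comp_le _ _).trans
          (by gcongr; exact ContinuousLinearMap.opNorm_comp_le _ _)
    _ ≤ 1 * (‖z‖ * 1) := by gcongr
    _ = ‖z‖ := by ring

/-- A bounded sequence with orthogonal increments in an inner product space is Cauchy. -/
theorem cauchySeq_of_inner_sub_eq_zero {E : Type*} [NormedAddCommGroup E]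
    [InnerProductSpace ℂ E] {v : ℕ → E} {C : ℝ} (hC : ∀ n, ‖v n‖ ≤ C)
    (h : ∀ n m, n ≤ m → ⟪v n, v m - v n⟫_ℂ = 0) : CauchySeq v := by
  have hp : ∀ n m, n ≤ m → ‖v m‖ ^ 2 = ‖v n‖ ^ 2 + ‖v m - v n‖ ^ 2 := fun n m hnm => by
    have := norm_add_sq_eq_norm_sq_add_norm_sq_of_inner_eq_zero (v n) (v m - v n) (h n m hnm)
    rw [add_sub_cancel] at this
    simpa only [sq] using this
  have hmono : Monotone fun n => ‖v n‖ ^ 2 := fun n m hnm => by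
    have := hp n m hnm
    have := sq_nonneg ‖v m - v n‖
    dsimp only
    linarith
  have hbdd : BddAbove (Set.range fun n => ‖v n‖ ^ 2) := by
    refine ⟨C ^ 2, ?_⟩
    rintro _ ⟨n, rfl⟩
    exact pow_le_pow_left₀ (norm_nonneg _) (hC n) 2
  have hlim := tendsto_atTop_ciSup hmono hbdd
  refine Metric.cauchySeq_iff'.2 fun ε hε => ?_
  obtain ⟨N, hN⟩ := Metric.cauchySeq_iff'.1 hlim.cauchySeq (ε ^ 2) (by positivity)
  refine ⟨N, fun n hn => ?_⟩
  have h1 := hN n hn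
  rw [Real.dist_eq, hp N n hn, add_sub_cancel_left, abs_of_nonneg (sq_nonneg _)] at h1
  rw [dist_eq_norm]
  exact lt_of_pow_lt_pow_left₀ 2 hε.le h1

namespace MinimalDilation

variable {A : VonNeumannAlgebra H} {τ : A.toStarSubalgebra →ₗ[ℂ] A.toStarSubalgebra}
variable (D : MinimalDilation τ K)

/-- The element `x` of `A`, viewed in `B`. -/
def ext (x : A.toStarSubalgebra) : D.B.toStarSubalgebra := ⟨extend D.V x, D.extend_mem x⟩

/-- The compression map as a linear map. -/
def Tₗ : D.B.toStarSubalgebra →ₗ[ℂ] A.toStarSubalgebra where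
  toFun := D.T
  map_add' y z := Subtype.ext (by ext v; simp [T, compress])
  map_smul' c z := Subtype.ext (by ext v; simp [T, compress])

theorem Tₗ_apply (z : D.B.toStarSubalgebra) : D.Tₗ z = D.T z := rfl

theorem T_ext (x : A.toStarSubalgebra) : D.T (D.ext x) = x :=
  Subtype.ext (compress_extend D.V x)

theorem ext_T (z : D.B.toStarSubalgebra) : D.ext (D.T z) = D.ext 1 * z * D.ext 1 :=
  Subtype.ext (extend_compress D.V z)

theorem ext_mul (x y : A.toStarSubalgebra) : D.ext (x * y) = D.ext x * D.ext y :=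
  Subtype.ext (extend_mul D.V x y)

theorem star_ext (x : A.toStarSubalgebra) : star (D.ext x) = D.ext (star x) :=
  Subtype.ext (star_extend D.V x)

theorem ext_one_mul_ext (x : A.toStarSubalgebra) : D.ext 1 * D.ext x = D.ext x := by
  rw [← ext_mul, one_mul]

theorem norm_T_le (z : D.B.toStarSubalgebra) : ‖D.T z‖ ≤ ‖z‖ := norm_compress_le D.V z

theorem norm_ext_le (x : A.toStarSubalgebra) : ‖D.ext x‖ ≤ ‖x‖ := norm_extend_le D.V x

theorem T_iterate_ext (n : ℕ) (x : A.toStarSubalgebra) : D.T (D.θ^[n] (D.ext x)) = τ^[n] x :=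
  Subtype.ext (D.dilation n x).symm

theorem norm_θ_le (z : D.B.toStarSubalgebra) : ‖D.θ z‖ ≤ ‖z‖ := by
  have := isClosed_vonNeumannAlgebra D.B
  exact NonUnitalStarAlgHom.norm_apply_le D.θ z

theorem norm_θ_iterate_le (n : ℕ) (z : D.B.toStarSubalgebra) : ‖D.θ^[n] z‖ ≤ ‖z‖ := by
  induction n with
  | zero => rfl
  | succ n ih => rw [Function.iterate_succ_apply']; exact (D.norm_θ_le _).trans ih

/-! ### The filtration by the projections `θⁿ(p)` -/

/-- The increasing projections `θⁿ(p)`. -/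
def proj (n : ℕ) : D.B.toStarSubalgebra := D.θ^[n] (D.ext 1)

theorem proj_zero : D.proj 0 = D.ext 1 := rfl

theorem θ_proj (n : ℕ) : D.θ (D.proj n) = D.proj (n + 1) :=
  (Function.iterate_succ_apply' _ _ _).symm

theorem proj_mul_self (n : ℕ) : D.proj n * D.proj n = D.proj n := by
  rw [proj, ← iterate_map_mul, ext_one_mul_ext]

theorem star_proj (n : ℕ) : star (D.proj n) = D.proj n := by
  induction n with
  | zero => rw [proj_zero, star_ext, star_one]
  | succ n ih => rw [← θ_proj, ← map_star, ih]

theorem norm_proj_le (n : ℕ) : ‖D.proj n‖ ≤ 1 := by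
  refine (D.norm_θ_iterate_le n _).trans ((D.norm_ext_le 1).trans ?_)
  exact ContinuousLinearMap.norm_id_le

theorem norm_proj_apply_le (n : ℕ) (ξ : K) : ‖(D.proj n).1 ξ‖ ≤ ‖ξ‖ :=
  ((D.proj n).1.le_of_opNorm_le (D.norm_proj_le n) ξ).trans_eq (one_mul _)

/-- Unitality gives `p θ(p) p = p`, so `d = p - θ(p)p` satisfies `d⋆d = p - p θ(p) p = 0`. -/
theorem proj_one_mul_proj_zero (h1 : τ 1 = 1) : D.proj 1 * D.proj 0 = D.proj 0 := by
  have h : D.proj 0 * D.proj 1 * D.proj 0 = D.proj 0 := by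
    have := D.T_iterate_ext 1 1
    rw [Function.iterate_one τ, h1] at this
    rw [proj_zero, ← ext_T, proj, this]
  have hz : star (D.proj 0 - D.proj 1 * D.proj 0) * (D.proj 0 - D.proj 1 * D.proj 0) = 0 := by
    simp only [star_sub, star_mul, star_proj, sub_mul, mul_sub, proj_mul_self, h]
    rw [← mul_assoc (D.proj 0), h, mul_assoc (D.proj 0) (D.proj 1),
      ← mul_assoc (D.proj 1) (D.proj 1), proj_mul_self, ← mul_assoc, h]
    simp
  rw [CStarRing.star_mul_self_eq_zero_iff, sub_eq_zero] at hz
  exact hz.symm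

theorem proj_succ_mul_proj (h1 : τ 1 = 1) (n : ℕ) : D.proj (n + 1) * D.proj n = D.proj n := by
  induction n with
  | zero => exact D.proj_one_mul_proj_zero h1
  | succ n ih => simpa only [map_mul, θ_proj] using congrArg D.θ ih

theorem proj_mul_proj_of_le (h1 : τ 1 = 1) {n m : ℕ} (h : n ≤ m) :
    D.proj m * D.proj n = D.proj n := by
  induction m, h using Nat.le_induction with
  | base => exact D.proj_mul_self n
  | succ m _ ih => rw [← ih, ← mul_assoc, D.proj_succ_mul_proj h1]

theorem proj_mul_proj_of_le' (h1 : τ 1 = 1) {n m : ℕ} (h : n ≤ m) :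
    D.proj n * D.proj m = D.proj n := by
  have := congrArg star (D.proj_mul_proj_of_le h1 h)
  simpa only [star_mul, star_proj] using this

/-- The compression intertwines `θ` with `τ`. -/
theorem T_θ (h1 : τ 1 = 1) (z : D.B.toStarSubalgebra) : D.T (D.θ z) = τ (D.T z) := by
  -- The dilation identity for `pzp`: `θ(pzp) = p_1 θ(z) p_1`, and the outer compression by `p ≤
  -- p_1` absorbs both `p_1`.
  have h := D.T_iterate_ext 1 (D.T z)
  rw [Function.iterate_one, Function.iterate_one τ, ext_T, ← proj_zero, map_mul, map_mul,
    θ_proj] at h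
  rw [← h, ← D.T_ext (D.T (D.θ z)), ← D.T_ext (D.T (D.proj _ * D.θ z * D.proj _)), ext_T, ext_T,
    ← proj_zero]
  have e1 : D.proj 0 * D.proj (0 + 1) = D.proj 0 := D.proj_mul_proj_of_le' h1 zero_le_one
  have e2 : D.proj (0 + 1) * D.proj 0 = D.proj 0 := D.proj_mul_proj_of_le h1 zero_le_one
  simp only [mul_assoc, e2]
  rw [← mul_assoc (D.proj 0) (D.proj (0 + 1)), e1]

theorem proj_mul_word (n : ℕ) (x : ℕ → A.toStarSubalgebra) (h : H) :
    (D.proj n).1 ((word (R := D.B.toStarSubalgebra) D.θ (fun i => D.ext (x i)) n).1 (D.V h)) =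
      (word (R := D.B.toStarSubalgebra) D.θ (fun i => D.ext (x i)) n).1 (D.V h) := by
  cases n with
  | zero => exact extend_apply_V D.V 1 h
  | succ n =>
    have : D.proj (n + 1) * word (R := D.B.toStarSubalgebra) D.θ (fun i => D.ext (x i)) (n + 1) =
        word (R := D.B.toStarSubalgebra) D.θ (fun i => D.ext (x i)) (n + 1) := by
      rw [word, ← mul_assoc, proj, ← iterate_map_mul, ext_one_mul_ext]
    exact congrArg (fun z : D.B.toStarSubalgebra => z.1 (D.V h)) this

/-- By minimality of the space, the projections `θⁿ(p)` tend strongly to `1`. -/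
theorem tendsto_proj (h1 : τ 1 = 1) (ξ : K) :
    Tendsto (fun n => (D.proj n).1 ξ) atTop (𝓝 ξ) := by
  let S : Submodule ℂ K :=
    { carrier := {η | Tendsto (fun n => (D.proj n).1 η) atTop (𝓝 η)}
      add_mem' := fun ha hb => by simpa using! ha.add hb
      zero_mem' := by simp
      smul_mem' := fun c _ ha => by simpa using! ha.const_smul c }
  have hle : Submodule.span ℂ {k : K | ∃ (n : ℕ) (x : ℕ → A.toStarSubalgebra) (h : H),
      k = (word (R := D.B.toStarSubalgebra) D.θ (fun i => ⟨extend D.V (x i), D.extend_mem (x i)⟩)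
        n).1 (D.V h)} ≤ S := by
    rw [Submodule.span_le]
    rintro _ ⟨n, x, h, rfl⟩
    refine tendsto_const_nhds.congr' ?_
    filter_upwards [eventually_ge_atTop n] with m hm
    have e := D.proj_mul_word n x h
    have e' := congrArg (fun z : D.B.toStarSubalgebra => z.1
      ((word (R := D.B.toStarSubalgebra) D.θ (fun i => D.ext (x i)) n).1 (D.V h)))
      (D.proj_mul_proj_of_le h1 hm)
    change (D.proj m).1 ((D.proj n).1 _) = (D.proj n).1 _ at e'
    rw [e] at e'
    exact e'.symm
  -- Strong convergence passes to the closure because the `p_n` are uniformly contractive.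
  have hS : IsClosed (S : Set K) := by
    refine isClosed_of_closure_subset fun η hη => ?_
    refine Metric.tendsto_atTop.2 fun ε hε => ?_
    obtain ⟨ζ, hζ, hd⟩ := Metric.mem_closure_iff.1 hη (ε / 3) (by positivity)
    obtain ⟨N, hN⟩ := Metric.tendsto_atTop.1 hζ (ε / 3) (by positivity)
    refine ⟨N, fun n hn => ?_⟩
    have a := hN n hn
    have b : dist ((D.proj n).1 η) ((D.proj n).1 ζ) ≤ dist η ζ := by
      rw [dist_eq_norm, dist_eq_norm, ← map_sub]
      exact D.norm_proj_apply_le n _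
    have c := dist_triangle4_right ((D.proj n).1 η) η ((D.proj n).1 ζ) ζ
    linarith
  have h := Submodule.topologicalClosure_minimal _ hle hS
  rw [D.minimal_space] at h
  exact h (Submodule.mem_top (x := ξ))

theorem tendsto_proj_mul_mul_proj (h1 : τ 1 = 1) (z : D.B.toStarSubalgebra) (ξ : K) :
    Tendsto (fun n => (D.proj n * z * D.proj n).1 ξ) atTop (𝓝 (z.1 ξ)) := by
  have h2 : Tendsto (fun n => (D.proj n).1 (z.1 ((D.proj n).1 ξ) - z.1 ξ)) atTop (𝓝 0) := by
    have h3 := (((z.1.continuous.tendsto _).comp (D.tendsto_proj h1 ξ)).sub_const (z.1 ξ)).norm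
    rw [sub_self, norm_zero] at h3
    exact squeeze_zero_norm (fun n => D.norm_proj_apply_le n _) h3
  have h4 := h2.add (D.tendsto_proj h1 (z.1 ξ))
  rw [zero_add] at h4
  refine h4.congr fun n => ?_
  rw [← map_add, sub_add_cancel]
  rfl

theorem eq_of_proj_mul_mul_proj_eq (h1 : τ 1 = 1) {y z : D.B.toStarSubalgebra}
    (h : ∀ᶠ n in atTop, D.proj n * y * D.proj n = D.proj n * z * D.proj n) : y = z := by
  refine Subtype.ext (ContinuousLinearMap.ext fun ξ => ?_)
  refine tendsto_nhds_unique ((D.tendsto_proj_mul_mul_proj h1 y ξ).congr' ?_)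
    (D.tendsto_proj_mul_mul_proj h1 z ξ)
  filter_upwards [h] with n hn
  rw [hn]

theorem inner_proj_apply_sub (n : ℕ) (ξ : K) :
    ⟪(D.proj n).1 ξ, ξ - (D.proj n).1 ξ⟫_ℂ = 0 := by
  have hs : (D.proj n).1.adjoint = (D.proj n).1 := congrArg Subtype.val (D.star_proj n)
  have hm : (D.proj n).1 ((D.proj n).1 ξ) = (D.proj n).1 ξ :=
    congrArg (fun z : D.B.toStarSubalgebra => z.1 ξ) (D.proj_mul_self n)
  rw [← ContinuousLinearMap.adjoint_inner_right, hs, map_sub, hm, sub_self, inner_zero_right]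

/-! ### Lifting peripheral eigenvectors -/

/-- The operators `λ⁻ⁿ θⁿ(x)`. -/
def approx (l : ℂ) (x : A.toStarSubalgebra) (n : ℕ) : D.B.toStarSubalgebra :=
  l⁻¹ ^ n • D.θ^[n] (D.ext x)

theorem norm_approx_le {l : ℂ} (hl : ‖l‖ = 1) (x : A.toStarSubalgebra) (n : ℕ) :
    ‖D.approx l x n‖ ≤ ‖x‖ := by
  rw [approx, norm_smul, norm_pow, norm_inv, hl, inv_one, one_pow, one_mul]
  exact (D.norm_θ_iterate_le n _).trans (D.norm_ext_le x)

theorem iterate_eq_pow_smul {l : ℂ} {x : A.toStarSubalgebra} (hx : τ x = l • x) (n : ℕ) :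
    τ^[n] x = l ^ n • x := by
  induction n with
  | zero => simp
  | succ n ih => rw [Function.iterate_succ_apply', ih, map_smul, hx, smul_smul, pow_succ]

theorem ext_smul (c : ℂ) (x : A.toStarSubalgebra) : D.ext (c • x) = c • D.ext x :=
  Subtype.ext (by ext v; simp [ext, extend])

theorem θ_iterate_smul (n : ℕ) (c : ℂ) (z : D.B.toStarSubalgebra) :
    D.θ^[n] (c • z) = c • D.θ^[n] z := by
  induction n with
  | zero => rfl
  | succ n ih => rw [Function.iterate_succ_apply', ih, map_smul, Function.iterate_succ_apply']

/-- The martingale property: `p_n θⁿ⁺ᵏ(x) p_n = θⁿ(p θᵏ(x) p) = θⁿ(τᵏ(x)) = λᵏ θⁿ(x)`. -/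
theorem proj_mul_approx_mul_proj {l : ℂ} (hl : ‖l‖ = 1) {x : A.toStarSubalgebra}
    (hx : τ x = l • x) (n k : ℕ) :
    D.proj n * D.approx l x (n + k) * D.proj n = D.approx l x n := by
  have h0 : l ≠ 0 := by
    rintro rfl
    simp at hl
  rw [approx, approx, mul_smul_comm, smul_mul_assoc, Function.iterate_add_apply, proj,
    ← iterate_map_mul, ← iterate_map_mul, ← ext_T, T_iterate_ext, iterate_eq_pow_smul hx,
    ext_smul, θ_iterate_smul, smul_smul, pow_add, mul_assoc, ← mul_pow, inv_mul_cancel₀ h0,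
    one_pow, mul_one]

/-- For `k ≤ j`, `a_{n+k} p_n = p_{n+k} a_{n+j} p_n`, so each vector is an orthogonal projection of
the later ones and the increments are orthogonal. -/
theorem cauchySeq_approx_proj (h1 : τ 1 = 1) {l : ℂ} (hl : ‖l‖ = 1) {x : A.toStarSubalgebra}
    (hx : τ x = l • x) (n : ℕ) (ξ : K) :
    CauchySeq fun k => (D.approx l x (n + k) * D.proj n).1 ξ := by
  refine cauchySeq_of_inner_sub_eq_zero (C := ‖x‖ * ‖ξ‖) (fun k => ?_) fun k j hkj => ?_
  · have h : ‖D.approx l x (n + k) * D.proj n‖ ≤ ‖x‖ :=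
      (norm_mul_le _ _).trans ((mul_le_mul (D.norm_approx_le hl x _) (D.norm_proj_le n)
        (norm_nonneg _) (norm_nonneg _)).trans_eq (mul_one _))
    exact (D.approx l x (n + k) * D.proj n).1.le_of_opNorm_le h ξ
  · obtain ⟨i, rfl⟩ := Nat.exists_eq_add_of_le hkj
    have h := D.proj_mul_approx_mul_proj hl hx (n + k) i
    have h' : D.approx l x (n + k) * D.proj n =
        D.proj (n + k) * (D.approx l x (n + (k + i)) * D.proj n) := by
      rw [← h, mul_assoc, D.proj_mul_proj_of_le h1 (Nat.le_add_right n k), mul_assoc, add_assoc]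
    rw [h']
    exact D.inner_proj_apply_sub (n + k) _

theorem cauchySeq_approx (h1 : τ 1 = 1) {l : ℂ} (hl : ‖l‖ = 1) {x : A.toStarSubalgebra}
    (hx : τ x = l • x) (ξ : K) : CauchySeq fun k => (D.approx l x k).1 ξ := by
  refine Metric.cauchySeq_iff'.2 fun ε hε => ?_
  have hx0 : 0 < ‖x‖ + 1 := by positivity
  obtain ⟨n, hn⟩ := (Metric.tendsto_atTop.1 (D.tendsto_proj h1 ξ)) (ε / 3 / (‖x‖ + 1))
    (by positivity)
  obtain ⟨N, hN⟩ := Metric.cauchySeq_iff'.1 (D.cauchySeq_approx_proj h1 hl hx n ξ) (ε / 3)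
    (by positivity)
  have hb : ∀ m, dist ((D.approx l x m).1 ξ) ((D.approx l x m * D.proj n).1 ξ) < ε / 3 := by
    intro m
    have hn := hn n le_rfl
    change dist ((D.approx l x m).1 ξ) ((D.approx l x m).1 ((D.proj n).1 ξ)) < ε / 3
    rw [dist_eq_norm, ← map_sub]
    rw [lt_div_iff₀ hx0, dist_comm, dist_eq_norm] at hn
    calc _ ≤ ‖x‖ * ‖ξ - (D.proj n).1 ξ‖ :=
          (D.approx l x m).1.le_of_opNorm_le (D.norm_approx_le hl x m) _
      _ ≤ ‖ξ - (D.proj n).1 ξ‖ * (‖x‖ + 1) := by nlinarith [norm_nonneg (ξ - (D.proj n).1 ξ)]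
      _ < ε / 3 := hn
  refine ⟨n + N, fun m hm => ?_⟩
  obtain ⟨i, rfl⟩ := Nat.exists_eq_add_of_le hm
  have h2 := hN (N + i) (Nat.le_add_right _ _)
  rw [← add_assoc] at h2
  have h3 := hb (n + N)
  have h4 := hb (n + N + i)
  have h5 := dist_triangle4_right ((D.approx l x (n + N + i)).1 ξ) ((D.approx l x (n + N)).1 ξ)
    ((D.approx l x (n + N + i) * D.proj n).1 ξ) ((D.approx l x (n + N) * D.proj n).1 ξ)
  linarith

/-- Every peripheral eigenvector of `τ` is the compression of an eigenvector of `θ`. -/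
theorem exists_eigenvector_lift (h1 : τ 1 = 1) {l : ℂ} (hl : ‖l‖ = 1) {x : A.toStarSubalgebra}
    (hx : τ x = l • x) : ∃ z : D.B.toStarSubalgebra, D.θ z = l • z ∧ D.T z = x := by
  have h0 : l ≠ 0 := by
    rintro rfl
    simp at hl
  choose f hf using fun ξ => cauchySeq_tendsto_of_complete (D.cauchySeq_approx h1 hl hx ξ)
  let Z : K →L[ℂ] K := continuousLinearMapOfTendsto (fun k => (D.approx l x k).1)
    (tendsto_pi_nhds.2 hf)
  have hZ : ∀ ξ, Tendsto (fun k => (D.approx l x k).1 ξ) atTop (𝓝 (Z ξ)) := hf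
  let z : D.B.toStarSubalgebra := ⟨Z, mem_of_tendsto_apply D.B hZ⟩
  have hz : ∀ n, D.proj n * z * D.proj n = D.approx l x n := by
    intro n
    refine Subtype.ext (ContinuousLinearMap.ext fun ξ => ?_)
    refine tendsto_nhds_unique
      (((D.proj n).1.continuous.tendsto _).comp (hZ ((D.proj n).1 ξ))) ?_
    refine tendsto_const_nhds.congr' ?_
    filter_upwards [eventually_ge_atTop n] with m hm
    obtain ⟨i, rfl⟩ := Nat.exists_eq_add_of_le hm
    exact congrArg (fun z : D.B.toStarSubalgebra => z.1 ξ)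
      (D.proj_mul_approx_mul_proj hl hx n i).symm
  refine ⟨z, D.eq_of_proj_mul_mul_proj_eq h1 ?_, ?_⟩
  -- Compressions determine an operator, and `p_{k+1} θ(z) p_{k+1} = θ(p_k z p_k) = θ(a_k) = λ
  -- a_{k+1}`; `n ≥ 1` lets `p_n` be written as `θ(p_{n-1})`.
  · filter_upwards [eventually_ge_atTop 1] with n hn
    obtain ⟨k, rfl⟩ := Nat.exists_eq_add_of_le' hn
    rw [mul_smul_comm, smul_mul_assoc, hz, ← θ_proj, ← map_mul, ← map_mul, hz, approx, approx,
      map_smul, ← Function.iterate_succ_apply' D.θ, smul_smul, pow_succ', ← mul_assoc,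
      mul_inv_cancel₀ h0, one_mul]
  · have h := hz 0
    rw [proj_zero, ← ext_T, approx, pow_zero, one_smul, Function.iterate_zero, id] at h
    rw [← D.T_ext (D.T z), h, T_ext]

/-! ### Recurrence and isometry of the compression -/

/-- If `λ₁, …, λₖ` are unimodular, then `(λ₁ⁿ, …, λₖⁿ)` returns to every neighbourhood of
`(1, …, 1)`. -/
theorem frequently_pow_mem {ι : Type*} [Finite ι] {l : ι → ℂ} (hl : ∀ i, ‖l i‖ = 1)
    {s : Set (ι → ℂ)} (hs : s ∈ 𝓝 1) : ∃ᶠ n : ℕ in atTop, l ^ n ∈ s := by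
  let c : ι → Circle := fun i => ⟨l i, mem_sphere_zero_iff_norm.2 (hl i)⟩
  have hcont : Continuous fun (v : ι → Circle) (i : ι) => (v i : ℂ) := by fun_prop
  -- The torus is a compact group, so the powers of any element cluster at the identity.
  have h := (mapClusterPt_one_atTop_pow c).frequently
    (hcont.continuousAt.preimage_mem_nhds (by simpa [Pi.one_def] using hs))
  refine h.mono fun n hn => ?_
  have e : (fun i => (((c ^ n) i : Circle) : ℂ)) = l ^ n := by
    ext i
    rw [Pi.pow_apply, Pi.pow_apply, Circle.coe_pow]
  rw [← e]
  exact hn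

theorem norm_le_norm_T_of_sum (h1 : τ 1 = 1) {ι : Type*} [Fintype ι] {l : ι → ℂ}
    (hl : ∀ i, ‖l i‖ = 1) {z : ι → D.B.toStarSubalgebra} (hz : ∀ i, D.θ (z i) = l i • z i) :
    ‖∑ i, z i‖ ≤ ‖D.T (∑ i, z i)‖ := by
  refine le_of_forall_pos_le_add fun ε hε => ?_
  have hl0 : ∀ i, l i ≠ 0 := fun i hi => by simpa [hi] using hl i
  let w : (ι → ℂ) → D.B.toStarSubalgebra := fun c => ∑ i, c i • z i
  have hθ : ∀ n : ℕ, D.θ^[n] (w (l⁻¹ ^ n)) = ∑ i, z i := by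
    intro n
    induction n with
    | zero => simp [w]
    | succ n ih =>
      rw [Function.iterate_succ_apply, ← ih]
      congr 1
      simp only [w, map_sum, map_smul, hz, smul_smul]
      refine Finset.sum_congr rfl fun i _ => ?_
      simp [pow_succ, mul_assoc, inv_mul_cancel₀ (hl0 i)]
  have hb : ∀ n : ℕ, ‖D.proj n * (∑ i, z i) * D.proj n‖ ≤ ‖D.T (w (l⁻¹ ^ n))‖ := by
    intro n
    rw [← hθ n, proj, ← iterate_map_mul, ← iterate_map_mul, ← ext_T]
    exact (D.norm_θ_iterate_le n _).trans (D.norm_ext_le _)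
  have hcont : Continuous fun c : ι → ℂ => ‖D.T (w c)‖ := by
    have : ∀ c, D.T (w c) = ∑ i, c i • D.T (z i) := fun c => by
      simp only [← Tₗ_apply, w, map_sum, map_smul]
    simp only [this]
    fun_prop
  have hw : w 1 = ∑ i, z i := by simp [w]
  have hf := frequently_pow_mem (l := l⁻¹) (fun i => by simp [hl i])
    (hcont.continuousAt.preimage_mem_nhds (x := 1)
      (Iio_mem_nhds (show ‖D.T (w 1)‖ < ‖D.T (w 1)‖ + ε by linarith)))
  refine ContinuousLinearMap.opNorm_le_bound _ (by positivity) fun ξ => ?_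
  -- The full sequence converges, so a bound at the infinitely many return times suffices.
  refine le_of_tendsto_of_frequently (D.tendsto_proj_mul_mul_proj h1 (∑ i, z i) ξ).norm ?_
  refine hf.mono fun n hn => ?_
  refine ContinuousLinearMap.le_of_opNorm_le _ ((hb n).trans ?_) ξ
  rw [← hw]
  exact le_of_lt hn

/-- The compression is isometric on the span of the peripheral eigenvectors of `θ`. -/
theorem norm_T_of_mem_span (h1 : τ 1 = 1) {z : D.B.toStarSubalgebra}
    (hz : z ∈ Submodule.span ℂ {z : D.B.toStarSubalgebra |
      ∃ l : ℂ, ‖l‖ = 1 ∧ z ∈ Module.End.eigenspace D.θ.toAlgHom.toLinearMap l}) :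
    ‖D.T z‖ = ‖z‖ := by
  refine (D.norm_T_le z).antisymm ?_
  obtain ⟨n, c, g, rfl⟩ := Submodule.mem_span_set'.1 hz
  choose l hl hg using fun i => (g i).2
  refine D.norm_le_norm_T_of_sum h1 hl fun i => ?_
  have : D.θ (g i).1 = l i • (g i).1 := Module.End.mem_eigenspace_iff.1 (hg i)
  rw [map_smul, this, smul_comm]

theorem continuous_T : Continuous D.T :=
  AddMonoidHomClass.continuous_of_bound D.Tₗ 1 fun z => by
    rw [one_mul]
    exact D.norm_T_le z

/-- The compression is isometric on `P(θ)`. -/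
theorem norm_T_of_mem_peripheralθ (h1 : τ 1 = 1) {z : D.B.toStarSubalgebra}
    (hz : z ∈ D.peripheralθ) : ‖D.T z‖ = ‖z‖ :=
  closure_minimal (fun _ h => D.norm_T_of_mem_span h1 h)
    (isClosed_eq D.continuous_T.norm continuous_norm) hz

theorem isometry_T (h1 : τ 1 = 1) : Isometry fun z : D.peripheralθ => D.T z :=
  AddMonoidHomClass.isometry_of_norm (D.Tₗ ∘ₗ D.peripheralθ.subtype)
    fun z => D.norm_T_of_mem_peripheralθ h1 z.2

theorem injOn_T (h1 : τ 1 = 1) : Set.InjOn D.T D.peripheralθ :=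
  Set.injOn_iff_injective.2 (D.isometry_T h1).injective

/-! ### The bijection and the product -/

theorem mem_peripheralθ {l : ℂ} (hl : ‖l‖ = 1) {z : D.B.toStarSubalgebra}
    (hz : D.θ z = l • z) : z ∈ D.peripheralθ :=
  Submodule.le_topologicalClosure _
    (Submodule.subset_span ⟨l, hl, Module.End.mem_eigenspace_iff.2 hz⟩)

theorem mapsTo_T (h1 : τ 1 = 1) : Set.MapsTo D.T D.peripheralθ (peripheral τ) := by
  refine Set.MapsTo.closure ?_ D.continuous_T
  change Submodule.span ℂ _ ≤ Submodule.comap D.Tₗ (Submodule.span ℂ _)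
  rw [Submodule.span_le]
  rintro z ⟨l, hl, hz⟩
  have hz : D.θ z = l • z := Module.End.mem_eigenspace_iff.1 hz
  refine Submodule.subset_span ⟨l, hl, Module.End.mem_eigenspace_iff.2 ?_⟩
  rw [Tₗ_apply, ← D.T_θ h1, hz, ← Tₗ_apply, map_smul, Tₗ_apply]

/-- An isometry on a complete space has closed range, so it is enough to reach the eigenvectors. -/
theorem surjOn_T (h1 : τ 1 = 1) : Set.SurjOn D.T D.peripheralθ (peripheral τ) := by
  have : CompleteSpace D.B.toStarSubalgebra :=
    (isClosed_vonNeumannAlgebra D.B).completeSpace_coe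
  have hc : IsClosed (D.peripheralθ : Set D.B.toStarSubalgebra) :=
    Submodule.isClosed_topologicalClosure _
  have := hc.completeSpace_coe
  have hi : IsClosed (D.T '' D.peripheralθ) := by
    have h := (D.isometry_T h1).isClosedEmbedding.isClosed_range
    rwa [Set.image_eq_range]
  have hle : peripheral τ ≤ D.peripheralθ.map D.Tₗ := by
    refine Submodule.topologicalClosure_minimal _ (Submodule.span_le.2 ?_) hi
    rintro x ⟨l, hl, hx⟩
    obtain ⟨z, hz, rfl⟩ := D.exists_eigenvector_lift h1 hl (Module.End.mem_eigenspace_iff.1 hx)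
    exact ⟨z, D.mem_peripheralθ hl hz, rfl⟩
  exact hle

theorem bijOn_T (h1 : τ 1 = 1) : Set.BijOn D.T D.peripheralθ (peripheral τ) :=
  ⟨D.mapsTo_T h1, D.injOn_T h1, D.surjOn_T h1⟩

theorem lift_T (h1 : τ 1 = 1) {z : D.B.toStarSubalgebra} (hz : z ∈ D.peripheralθ) :
    D.lift (D.T z) = z :=
  (D.injOn_T h1).leftInvOn_invFunOn hz

theorem prod_mem_eigenspace (h1 : τ 1 = 1) {l m : ℂ} (hl : ‖l‖ = 1) (hm : ‖m‖ = 1)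
    {x y : A.toStarSubalgebra} (hx : x ∈ Module.End.eigenspace τ l)
    (hy : y ∈ Module.End.eigenspace τ m) : D.prod x y ∈ Module.End.eigenspace τ (l * m) := by
  obtain ⟨z, hz, rfl⟩ := D.exists_eigenvector_lift h1 hl (Module.End.mem_eigenspace_iff.1 hx)
  obtain ⟨w, hw, rfl⟩ := D.exists_eigenvector_lift h1 hm (Module.End.mem_eigenspace_iff.1 hy)
  rw [prod, D.lift_T h1 (D.mem_peripheralθ hl hz), D.lift_T h1 (D.mem_peripheralθ hm hw),
    Module.End.mem_eigenspace_iff, ← D.T_θ h1, map_mul, hz, hw, smul_mul_smul_comm, ← Tₗ_apply,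
    map_smul, Tₗ_apply]

end MinimalDilation

end PeripheralBoundary

end

theorem corollary2p7
    {H : Type*} [NormedAddCommGroup H] [InnerProductSpace ℂ H] [CompleteSpace H]
    {K : Type*} [NormedAddCommGroup K] [InnerProductSpace ℂ K] [CompleteSpace K]
    (A : VonNeumannAlgebra H) (τ : A.toStarSubalgebra →ₗ[ℂ] A.toStarSubalgebra)
    (hτ : PeripheralBoundary.IsNormalUCP τ)
    (D : PeripheralBoundary.MinimalDilation τ K) :
    -- `T : P(θ) → P(τ)` is a bijection, so that the product `∘` is well defined on `P(τ)`
    Set.BijOn D.T D.peripheralθ (PeripheralBoundary.peripheral τ) ∧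
    ∀ (l m : ℂ), ‖l‖ = 1 → ‖m‖ = 1 →
      ∀ x ∈ Module.End.eigenspace τ l, ∀ y ∈ Module.End.eigenspace τ m,
        D.prod x y ∈ Module.End.eigenspace τ (l * m) ∧
        (¬ Module.End.HasEigenvalue τ (l * m) → D.prod x y = 0) := by
  refine ⟨D.bijOn_T hτ.map_one, fun l m hl hm x hx y hy => ?_⟩
  have h := D.prod_mem_eigenspace hτ.map_one hl hm hx hy
  refine ⟨h, fun hne => ?_⟩
  rw [Module.End.hasEigenvalue_iff, not_not] at hne
  rwa [hne, Submodule.mem_bot] at h
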